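/- Let $n\in\mathbb{N}$, let $x_0,\xi_0\in\mathbb{R}^n$ with $|\xi_0|=1$, let $b\in C_c^\infty(\mathbb{R}^n)$ be complex-valued, and let $A\in\mathbb{C}^{n\times n}$ have positive definite imaginary part, i.e. $\operatorname{Im}\langle Av,v\rangle>0$ for all $0\ne v\in\mathbb{R}^n$, where $\langle Av,v\rangle=\sum_{p,q}A_{pq}v_qv_p$. For real $k\ge1$ let $h_k$ be the coherent state $$h_k(x)=k^{n/4}\,e^{ik\langle x-x_0,\xi_0\rangle}\,e^{\frac{ik}{2}\langle A(x-x_0),\,x-x_0\rangle}\,b(x),\qquad x\in\mathbb{R}^n.$$ For $\mu\in\mathbb{R}$ let $S^\mu(\mathbb{R}^{2n})$ be the set of $a\in C^\infty(\mathbb{R}^n\times\mathbb{R}^n;\mathbb{C})$ such that for all multi-indices $\alpha,\beta$ there is a constant $C_{\alpha,\beta}$ with $|\partial_x^\alpha\partial_\xi^\beta a(x,\xi)|\le C_{\alpha,\beta}(1+|\xi|)^{\mu-|\beta|}$ for all $x,\xi\in\mathbb{R}^n$, and for $u\in C_c^\infty(\mathbb{R}^n)$ let $$\operatorname{Op}(a)u(x)=(2\pi)^{-n}\int_{\mathbb{R}^n}\int_{\mathbb{R}^n}e^{i\langle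 x-y,\xi\rangle}a(x,\xi)u(y)\,dy\,d\xi.$$ Let $m\in\mathbb{R}$ and let $a\in S^m_{c\ell}(\mathbb{R}^{2n})$ be a polyhomogeneous symbol with compact support in $x$ (there is a compact $K\subset\mathbb{R}^n$ with $a(x,\xi)=0$ for all $x\notin K$ and all $\xi$) and with polyhomogeneous expansion $a\sim\sum_{j\ge0}a_{m-j}$. This means: for every $j\ge0$, $a_{m-j}\in S^{m-j}(\mathbb{R}^{2n})$ and there is $c_j\in(0,1)$ such that $a_{m-j}(x,s\xi)=s^{m-j}a_{m-j}(x,\xi)$ for all $x,\xi$ and all $s>0$ with $|\xi|\ge c_j$ and $|s\xi|\ge c_j$; and $a-\sum_{j=0}^{N-1}a_{m-j}\in S^{m-N}(\mathbb{R}^{2n})$ for every integer $N\ge0$. Suppose that there is an $\ell\in\mathbb{N}=\{0,1,2,\dots\}$ such that for every $j\le\ell/2$ the function $a_{m-j}$ vanishes to order $\ell-2j$ at $(x_0,\xi_0)$, i.e. all its partial derivatives (in $x$ and $\xi$) of total order less than $\ell-2j$ vanish at $(x_0,\xi_0)$. Then $\operatorname{Op}(a)h_k\in L^2(\mathbb{R}^n)$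 for every $k\ge1$, and for every $\varepsilon>0$ there is a constant $C_\varepsilon>0$, independent of $k$, such that $$\|\operatorname{Op}(a)h_k\|_{L^2(\mathbb{R}^n)}\le C_\varepsilon\,k^{m-\frac{\ell}{2}+\varepsilon}\qquad\text{for all }k\ge1.$$ -/

import Mathlib

open MeasureTheory Complex
open scoped ContDiff

/-- The Euclidean space `ℝⁿ`. -/
abbrev RSpace (n : ℕ) : Type := EuclideanSpace ℝ (Fin n)

/-- The Kohn-Nirenberg symbol class `S^m(ℝ²ⁿ)`: smooth functions `a(x, ξ)` with
`|∂_x^α ∂_ξ^β a(x, ξ)| ≤ C_{α,β} (1 + |ξ|)^{m - |β|}` for all multi-indices `α`, `β`. The partial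
derivatives with `|α| = p` and `|β| = q` are grouped into the Fréchet derivative of order `p` in `x`
of the Fréchet derivative of order `q` in `ξ`. -/
structure IsSymbol {n : ℕ} (m : ℝ) (a : RSpace n × RSpace n → ℂ) : Prop where
  smooth : ContDiff ℝ ∞ a
  bound : ∀ p q : ℕ, ∃ C : ℝ, ∀ x ξ : RSpace n,
    ‖iteratedFDeriv ℝ p (fun x' => iteratedFDeriv ℝ q (fun ξ' => a (x', ξ')) ξ) x‖
      ≤ C * (1 + ‖ξ‖) ^ (m - (q : ℝ))

/-- `a` is positively homogeneous of degree `d` in `ξ` on the region `|ξ| ≥ c`. -/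
def IsHomogeneousAbove {n : ℕ} (c d : ℝ) (a : RSpace n × RSpace n → ℂ) : Prop :=
  ∀ (x ξ : RSpace n) (s : ℝ), 0 < s → c ≤ ‖ξ‖ → c ≤ ‖s • ξ‖ →
    a (x, s • ξ) = ((s ^ d : ℝ) : ℂ) * a (x, ξ)

/-- `a ∼ ∑_{j ≥ 0} a_{m-j}` is a polyhomogeneous expansion of order `m`, where `aj j` stands for
`a_{m-j}`. The class `S^m_cl(ℝ²ⁿ)` consists of the functions `a` having such an expansion
(`remainder` with `N = 0` says that `a` is in `S^m`, and each `a_{m-j}` is in `S^{m-j}_cl`, being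
its own expansion). The threshold of homogeneity may depend on `j`; it lies below `1`, so that
`a_{m-j}` is homogeneous near the unit cosphere. -/
structure HasPolyhomogeneousExpansion {n : ℕ} (m : ℝ) (a : RSpace n × RSpace n → ℂ)
    (aj : ℕ → RSpace n × RSpace n → ℂ) : Prop where
  term_symbol : ∀ j : ℕ, IsSymbol (m - (j : ℝ)) (aj j)
  term_homogeneous : ∀ j : ℕ, ∃ c : ℝ, 0 < c ∧ c < 1 ∧ IsHomogeneousAbove c (m - (j : ℝ)) (aj j)
  remainder : ∀ N : ℕ,
    IsSymbol (m - (N : ℝ)) (fun z => a z - ∑ j ∈ Finset.range N, aj j z)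

/-- `f` vanishes to order `r` at `z`: all its derivatives of order less than `r` vanish there. -/
def VanishesToOrder {n : ℕ} (r : ℕ) (f : RSpace n × RSpace n → ℂ) (z : RSpace n × RSpace n) :
    Prop :=
  ∀ i : ℕ, i < r → iteratedFDeriv ℝ i f z = 0

/-- The bilinear quadratic form `⟨A v, v⟩ = ∑ A_{pq} v_q v_p` of a complex matrix at a real
vector. -/
noncomputable def matrixForm {n : ℕ} (A : Matrix (Fin n) (Fin n) ℂ) (v : RSpace n) : ℂ :=
  ∑ p, ∑ q, A p q * (v q : ℂ) * (v p : ℂ)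

/-- The imaginary part `(Im A_{pq})` is positive definite as a quadratic form on `ℝⁿ`; `A` need not
be symmetric. -/
def HasPosDefIm {n : ℕ} (A : Matrix (Fin n) (Fin n) ℂ) : Prop :=
  ∀ v : RSpace n, v ≠ 0 → 0 < ∑ p, ∑ q, (A p q).im * v q * v p

/-- The coherent state
`h_k(x) = k^{n/4} e^{i k ⟨x - x₀, ξ₀⟩} e^{(i k / 2) ⟨A (x - x₀), x - x₀⟩} b(x)`. -/
noncomputable def coherentState {n : ℕ} (x₀ ξ₀ : RSpace n) (A : Matrix (Fin n) (Fin n) ℂ)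
    (b : RSpace n → ℂ) (k : ℝ) (x : RSpace n) : ℂ :=
  ((k ^ ((n : ℝ) / 4) : ℝ) : ℂ) * exp (I * (k : ℂ) * ((inner ℝ (x - x₀) ξ₀ : ℝ) : ℂ))
    * exp (I * (k : ℂ) / 2 * matrixForm A (x - x₀)) * b x

/-- The standard (left) quantization
`Op(a) u (x) = (2π)^{-n} ∫ (∫ e^{i ⟨x - y, ξ⟩} a(x, ξ) u(y) dy) dξ`. -/
noncomputable def Op {n : ℕ} (a : RSpace n × RSpace n → ℂ) (u : RSpace n → ℂ) (x : RSpace n) : ℂ :=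
  (((2 * Real.pi) ^ n : ℝ) : ℂ)⁻¹ *
    ∫ ξ : RSpace n, ∫ y : RSpace n,
      exp (I * ((inner ℝ (x - y) ξ : ℝ) : ℂ)) * a (x, ξ) * u y


/-!
The substitution `x = x₀ + v / √k`, `ξ = k ξ₀ + 2π √k η` turns `Op a h_k` into a multiplier
operator, with multiplier `η ↦ a (x, k ξ₀ + 2π √k η)`, applied to a family of functions of `v` that
is bounded in the Schwartz space and evaluated at `v = √k (x - x₀)`. By homogeneity,
`a_{m-j} (x, k ξ₀ + 2π √k η)` is `k ^ (m - j)` times the value of `a_{m-j}` at a point whose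
distance from `(x₀, ξ₀)` is `O(k ^ (-1/2))`, up to factors polynomial in `v` and `η`. Vanishing to
order `ℓ - 2j` there gains `k ^ (j - ℓ/2)`, and so every term contributes `k ^ (m - ℓ/2)`; a
derivative in `η` costs `√k` but lowers the order in `ξ` by one, which compensates the lost order
of vanishing. The polynomial factors are absorbed by the Schwartz decay, and the factor `k ^ (n/4)`
makes the dilation by `√k` unitary on `L²`, so that there is not even a loss of `k ^ ε`.
-/

open Asymptotics SchwartzMap
open scoped FourierTransform Topology

section Families

lemma isBigO_top_of_norm_le {α V : Type*} [Norm V] {f : α → V} {g : α → ℝ} (C : ℝ)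
    (h : ∀ x, ‖f x‖ ≤ C * g x) (hg : ∀ x, 0 ≤ g x) : f =O[⊤] g :=
  isBigO_top.2 ⟨C, fun x => by simpa only [Real.norm_of_nonneg (hg x)] using h x⟩

variable {ι κ E : Type*} [NormedAddCommGroup E] [NormedSpace ℝ E]

/-- A family of smooth functions all of whose derivatives grow polynomially, the derivatives of
the member `F i` being bounded by multiples of `w i` that do not depend on `i`. -/
structure UniformlyTemperate (w : ι → ℝ) (F : ι → E → ℂ) : Prop where
  contDiff : ∀ i, ContDiff ℝ ∞ (F i)
  isBigO : ∀ q : ℕ, ∃ M : ℕ, (fun p : ι × E => iteratedFDeriv ℝ q (F p.1) p.2) =O[⊤]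
    fun p => w p.1 * (1 + ‖p.2‖) ^ M

/-- A family of Schwartz functions each of whose seminorms is bounded by a multiple of `w`; for
`w = 1` this is a bounded subset of the Schwartz space. -/
def UniformlySchwartz (w : ι → ℝ) (F : ι → 𝓢(E, ℂ)) : Prop :=
  ∀ p q : ℕ, (fun i => SchwartzMap.seminorm ℂ p q (F i)) =O[⊤] w

namespace UniformlyTemperate

variable {w w' : ι → ℝ} {F G : ι → E → ℂ}

lemma hasTemperateGrowth (hF : UniformlyTemperate w F) (i : ι) : (F i).HasTemperateGrowth := by
  refine ⟨hF.contDiff i, fun q => ?_⟩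
  obtain ⟨M, hM⟩ := hF.isBigO q
  obtain ⟨C, hC⟩ := isBigO_top.1 hM
  refine ⟨M, C * |w i|, fun v => (hC (i, v)).trans_eq ?_⟩
  rw [Real.norm_eq_abs, abs_mul, abs_of_nonneg (by positivity : 0 ≤ (1 + ‖v‖) ^ M), mul_assoc]

lemma mono (hF : UniformlyTemperate w F) (h : w =O[⊤] w') : UniformlyTemperate w' F :=
  ⟨hF.contDiff, fun q => (hF.isBigO q).imp fun _ hM =>
    hM.trans ((h.comp_tendsto Filter.tendsto_top).mul (isBigO_refl _ _))⟩

lemma add (hF : UniformlyTemperate w F) (hG : UniformlyTemperate w G) :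
    UniformlyTemperate w (fun i v => F i v + G i v) := by
  refine ⟨fun i => (hF.contDiff i).add (hG.contDiff i), fun q => ?_⟩
  obtain ⟨M, hM⟩ := hF.isBigO q
  obtain ⟨M', hM'⟩ := hG.isBigO q
  have raise_power {a b : ℕ} (hab : a ≤ b) : (fun p : ι × E => w p.1 * (1 + ‖p.2‖) ^ a) =O[⊤]
      fun p => w p.1 * (1 + ‖p.2‖) ^ b := by
    refine (isBigO_refl _ _).mul (isBigO_top_of_norm_le 1 (fun p => ?_) fun p => by positivity)
    rw [one_mul, Real.norm_of_nonneg (by positivity)]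
    exact pow_le_pow_right₀ (by linarith [norm_nonneg p.2]) hab
  have hadd : (fun p : ι × E => iteratedFDeriv ℝ q (fun v => F p.1 v + G p.1 v) p.2) =
      fun p => iteratedFDeriv ℝ q (F p.1) p.2 + iteratedFDeriv ℝ q (G p.1) p.2 := by
    ext1 p
    exact iteratedFDeriv_add_apply (((hF.contDiff p.1).of_le (by exact_mod_cast le_top)).contDiffAt)
      (((hG.contDiff p.1).of_le (by exact_mod_cast le_top)).contDiffAt)
  exact ⟨max M M', hadd ▸ (hM.trans (raise_power (le_max_left _ _))).add
    (hM'.trans (raise_power (le_max_right _ _)))⟩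

lemma sum {J : Type*} {s : Finset J} {H : J → ι → E → ℂ}
    (h : ∀ j ∈ s, UniformlyTemperate w (H j)) :
    UniformlyTemperate w (fun i v => ∑ j ∈ s, H j i v) := by
  classical
  induction s using Finset.induction_on with
  | empty => exact ⟨fun _ => by simpa using contDiff_const, fun q => ⟨0, by simp [isBigO_zero]⟩⟩
  | insert j s hj ih =>
    simp only [Finset.sum_insert hj]
    exact (h j (s.mem_insert_self j)).add (ih fun i hi => h i (Finset.mem_insert_of_mem hi))

end UniformlyTemperate

namespace UniformlySchwartz

variable {w w' : ι → ℝ} {F : ι → E → ℂ} {G : ι → 𝓢(E, ℂ)}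

lemma isBigO_finset_sup (hG : UniformlySchwartz w G) (s : Finset (ℕ × ℕ)) :
    (fun i => s.sup (schwartzSeminormFamily ℂ E ℂ) (G i)) =O[⊤] w := by
  refine IsBigO.trans (isBigO_top_of_norm_le 1 (fun i => ?_) fun i => ?_)
    (IsBigO.fun_sum (s := s) fun m _ => hG m.1 m.2)
  · rw [Real.norm_of_nonneg (apply_nonneg _ _), one_mul]
    exact Seminorm.finset_sup_apply_le (Finset.sum_nonneg fun m _ => apply_nonneg _ _)
      fun m hm => Finset.single_le_sum (f := fun m : ℕ × ℕ => SchwartzMap.seminorm ℂ m.1 m.2 (G i))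
        (fun m _ => apply_nonneg _ _) hm
  · exact Finset.sum_nonneg fun m _ => apply_nonneg _ _

lemma iff_isBigO_iteratedFDeriv : UniformlySchwartz w G ↔ ∀ N q : ℕ,
    (fun p : ι × E => (1 + ‖p.2‖) ^ N * ‖iteratedFDeriv ℝ q (G p.1) p.2‖) =O[⊤]
      fun p => w p.1 := by
  refine ⟨fun hG N q => ?_, fun hG p q => ?_⟩
  · refine IsBigO.trans (isBigO_top_of_norm_le (2 ^ N) (fun p => ?_) fun p => apply_nonneg _ _)
      ((hG.isBigO_finset_sup (Finset.Iic (N, q))).comp_tendsto (k := Prod.fst (β := E))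
        Filter.tendsto_top)
    rw [Real.norm_of_nonneg (by positivity)]
    exact one_add_le_sup_seminorm_apply (𝕜 := ℂ) (m := (N, q)) le_rfl le_rfl _ _
  · obtain ⟨C, hC⟩ := isBigO_top.1 (hG p q)
    refine isBigO_top.2 ⟨|C|, fun i => ?_⟩
    rw [Real.norm_of_nonneg (apply_nonneg _ _)]
    refine SchwartzMap.seminorm_le_bound _ _ _ _ (by positivity) fun v => ?_
    calc ‖v‖ ^ p * ‖iteratedFDeriv ℝ q (G i) v‖
        ≤ (1 + ‖v‖) ^ p * ‖iteratedFDeriv ℝ q (G i) v‖ := by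
          gcongr
          linarith
      _ ≤ C * ‖w i‖ := (le_abs_self _).trans (hC (i, v))
      _ ≤ |C| * ‖w i‖ := by gcongr; exact le_abs_self C

lemma comp (hG : UniformlySchwartz w G) (φ : κ → ι) :
    UniformlySchwartz (fun j => w (φ j)) (fun j => G (φ j)) :=
  fun p q => (hG p q).comp_tendsto Filter.tendsto_top

lemma map (hG : UniformlySchwartz w G) (L : 𝓢(E, ℂ) →L[ℂ] 𝓢(E, ℂ)) :
    UniformlySchwartz w (fun i => L (G i)) := by
  intro p q
  have hcont : Continuous ((schwartzSeminormFamily ℂ E ℂ (p, q)).comp L.toLinearMap) :=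
    ((schwartz_withSeminorms ℂ E ℂ).continuous_seminorm (p, q)).comp L.continuous
  obtain ⟨s, C, -, hC⟩ := Seminorm.bound_of_continuous (schwartz_withSeminorms ℂ E ℂ) _ hcont
  refine IsBigO.trans (isBigO_top_of_norm_le C (fun i => ?_) fun i => apply_nonneg _ _)
    (hG.isBigO_finset_sup s)
  rw [Real.norm_of_nonneg (apply_nonneg _ _)]
  exact hC (G i)

lemma smulLeft (hF : UniformlyTemperate w F) (hG : UniformlySchwartz w' G) :
    UniformlySchwartz (fun i => w i * w' i) (fun i => smulLeftCLM ℂ (F i) (G i)) := by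
  rw [iff_isBigO_iteratedFDeriv] at hG ⊢
  intro N q
  choose M hM using hF.isBigO
  have hterm (j : ℕ) : (fun p : ι × E => (1 + ‖p.2‖) ^ N * (q.choose j *
      ‖iteratedFDeriv ℝ j (F p.1) p.2‖ * ‖iteratedFDeriv ℝ (q - j) (G p.1) p.2‖)) =O[⊤]
      fun p => w p.1 * w' p.1 := by
    have hder : (fun p : ι × E => ‖iteratedFDeriv ℝ j (F p.1) p.2‖ *
        ((1 + ‖p.2‖) ^ N * ‖iteratedFDeriv ℝ (q - j) (G p.1) p.2‖)) =O[⊤]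
        fun p => w p.1 * ((1 + ‖p.2‖) ^ (N + M j) * ‖iteratedFDeriv ℝ (q - j) (G p.1) p.2‖) :=
      ((hM j).norm_left.mul (isBigO_refl _ _)).congr_right fun p => by ring
    exact ((hder.trans ((isBigO_refl _ _).mul (hG (N + M j) (q - j)))).const_mul_left
      (q.choose j : ℝ)).congr_left fun p => by ring
  refine IsBigO.trans (isBigO_top_of_norm_le 1 (fun p => ?_) fun p => ?_)
    (IsBigO.fun_sum (s := Finset.range (q + 1)) fun j _ => hterm j)
  · rw [Real.norm_of_nonneg (by positivity), smulLeftCLM_apply (hF.hasTemperateGrowth p.1),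
      one_mul, ← Finset.mul_sum]
    gcongr
    exact norm_iteratedFDeriv_smul_le (hF.contDiff p.1) ((G p.1).smooth ⊤) p.2
      (by exact_mod_cast le_top)
  · positivity

end UniformlySchwartz

end Families

section Calculus

variable {E F : Type*} [NormedAddCommGroup E] [NormedSpace ℝ E] [NormedAddCommGroup F]
  [NormedSpace ℝ F]

lemma isBigO_iteratedFDeriv_of_forall_lt_eq_zero {f : E → F} (hf : ContDiff ℝ ∞ f) {z : E} {r : ℕ}
    (h : ∀ i < r, iteratedFDeriv ℝ i f z = 0) (q : ℕ) :
    iteratedFDeriv ℝ q f =O[𝓝 z] fun y => ‖y - z‖ ^ (r - q) := by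
  have hsmooth (i : ℕ) : ContDiff ℝ 1 (iteratedFDeriv ℝ i f) :=
    hf.iteratedFDeriv_right (by exact_mod_cast le_top)
  induction hj : r - q generalizing q with
  | zero => simpa using (hsmooth q).continuous.continuousAt.isBigO_one ℝ
  | succ j ih =>
    obtain ⟨C, hC, hbound⟩ := (ih (q + 1) (by omega)).exists_nonneg
    obtain ⟨δ, hδ, hball⟩ := Metric.nhds_basis_closedBall.eventually_iff.1 hbound.bound
    refine IsBigO.of_bound C <|
      Filter.mem_of_superset (Metric.closedBall_mem_nhds z hδ) fun y hy => ?_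
    have hmean := (convex_closedBall z ‖y - z‖).norm_image_sub_le_of_norm_fderiv_le (𝕜 := ℝ)
      (f := iteratedFDeriv ℝ q f) (C := C * ‖y - z‖ ^ j) (x := z) (y := y)
      (fun w _ => ((hsmooth q).differentiable one_ne_zero).differentiableAt) (fun w hw => ?_)
      (by simp) (by simp [dist_eq_norm])
    · simpa [h q (by omega), pow_succ, mul_assoc] using hmean
    · have hwy : ‖w - z‖ ≤ ‖y - z‖ := by simpa [dist_eq_norm] using hw
      have hyδ : ‖y - z‖ ≤ δ := by simpa [dist_eq_norm] using hy
      rw [norm_fderiv_iteratedFDeriv]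
      refine (hball (by simpa [dist_eq_norm] using hwy.trans hyδ)).trans ?_
      rw [norm_pow, norm_norm]
      gcongr

lemma iteratedFDeriv_comp_affine {f : E → F} (hf : ContDiff ℝ ∞ f) (q : ℕ) (c : E) (s : ℝ) (v : E) :
    iteratedFDeriv ℝ q (fun v => f (c + s • v)) v = s ^ q • iteratedFDeriv ℝ q f (c + s • v) := by
  have h : ContDiff ℝ q (fun v => f (c + v)) :=
    (hf.comp (contDiff_const.add contDiff_id)).of_le (by exact_mod_cast le_top)
  rw [iteratedFDeriv_comp_const_smul (f := fun v => f (c + v)) s h]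
  simp only [iteratedFDeriv_comp_add_left]

lemma norm_iteratedFDeriv_partial_right_le {E' : Type*} [NormedAddCommGroup E'] [NormedSpace ℝ E']
    {f : E × E' → F} (hf : ContDiff ℝ ∞ f) (q : ℕ) (x : E) (ξ : E') :
    ‖iteratedFDeriv ℝ q (fun ξ' => f (x, ξ')) ξ‖ ≤ ‖iteratedFDeriv ℝ q f (x, ξ)‖ := by
  have hshift : ContDiff ℝ ∞ fun z => f ((x, 0) + z) := by fun_prop
  have hslice : (fun ξ' => f (x, ξ')) =
      (fun z => f ((x, 0) + z)) ∘ ContinuousLinearMap.inr ℝ E E' := by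
    ext ξ'
    simp
  rw [hslice, ContinuousLinearMap.iteratedFDeriv_comp_right _ hshift _
    (by exact_mod_cast le_top : (q : WithTop ℕ∞) ≤ ∞), iteratedFDeriv_comp_add_left]
  refine (ContinuousMultilinearMap.norm_compContinuousLinearMap_le _ _).trans ?_
  have hprod : ∏ _i : Fin q, ‖ContinuousLinearMap.inr ℝ E E'‖ ≤ 1 :=
    Finset.prod_le_one (fun _ _ => norm_nonneg _) fun _ _ =>
      ContinuousLinearMap.norm_inr_le_one ℝ E E'
  simpa using mul_le_of_le_one_right (norm_nonneg (iteratedFDeriv ℝ q f (x, ξ))) hprod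

end Calculus

section Exponential

variable {ι E : Type*} [NormedAddCommGroup E] [NormedSpace ℝ E]

lemma norm_iteratedFDeriv_cexp (q : ℕ) (z : ℂ) :
    ‖iteratedFDeriv ℝ q exp z‖ = ‖exp z‖ * ‖iteratedFDeriv ℝ q exp 0‖ := by
  have h := iteratedFDeriv_comp_add_left (𝕜 := ℝ) (f := exp) q z 0
  have hmul : (fun w => exp (z + w)) = exp z • exp := by
    ext w
    simp [Complex.exp_add]
  rw [add_zero, hmul, iteratedFDeriv_const_smul_apply contDiff_exp.contDiffAt] at h
  rw [← h, norm_smul]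

lemma norm_iteratedFDeriv_cexp_comp_le {φ : E → ℂ} (hφ : φ.HasTemperateGrowth) (q : ℕ) :
    ∃ (M : ℕ) (C : ℝ), 0 ≤ C ∧ ∀ v, ‖iteratedFDeriv ℝ q (fun v => exp (φ v)) v‖ ≤
      C * (1 + ‖v‖) ^ M * Real.exp (φ v).re := by
  obtain ⟨M, C, hC, hbound⟩ := hφ.norm_iteratedFDeriv_le_uniform q
  set S := ∑ i ∈ Finset.range (q + 1), ‖iteratedFDeriv ℝ i exp (0 : ℂ)‖
  refine ⟨M * q, q.factorial * S * (1 + C) ^ q, by positivity, fun v => ?_⟩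
  have hcomp : ‖iteratedFDeriv ℝ q (exp ∘ φ) v‖ ≤
      q.factorial * (Real.exp (φ v).re * S) * ((1 + C) * (1 + ‖v‖) ^ M) ^ q := by
    refine norm_iteratedFDeriv_comp_le (N := ∞) contDiff_exp hφ.1 (by exact_mod_cast le_top) v
      (fun i hi => ?_) (fun i hi hiq => ?_)
    · rw [norm_iteratedFDeriv_cexp, Complex.norm_exp]
      gcongr
      exact Finset.single_le_sum (f := fun i => ‖iteratedFDeriv ℝ i exp (0 : ℂ)‖)
        (fun _ _ => norm_nonneg _) (Finset.mem_range.2 (by omega))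
    · have hone : 1 ≤ (1 + ‖v‖) ^ M := one_le_pow₀ (by linarith [norm_nonneg v])
      calc ‖iteratedFDeriv ℝ i φ v‖ ≤ C * (1 + ‖v‖) ^ M := hbound i hiq v
        _ ≤ (1 + C) * (1 + ‖v‖) ^ M := by gcongr; linarith
        _ ≤ ((1 + C) * (1 + ‖v‖) ^ M) ^ i :=
          le_self_pow₀ (one_le_mul_of_one_le_of_one_le (by linarith) hone) (by omega)
  refine hcomp.trans_eq ?_
  rw [mul_pow, ← pow_mul]
  ring

lemma one_add_pow_mul_exp_neg_sq_le {c t : ℝ} (hc : 0 < c) (ht : 0 ≤ t) (N : ℕ) :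
    (1 + t) ^ N * Real.exp (-(c * t ^ 2)) ≤ Real.exp (N ^ 2 / (4 * c)) := by
  calc (1 + t) ^ N * Real.exp (-(c * t ^ 2)) ≤ Real.exp t ^ N * Real.exp (-(c * t ^ 2)) := by
        gcongr
        linarith [Real.add_one_le_exp t]
    _ = Real.exp (N * t - c * t ^ 2) := by
        rw [← Real.exp_nat_mul, ← Real.exp_add]
        ring_nf
    _ ≤ Real.exp (N ^ 2 / (4 * c)) := by
        rw [Real.exp_le_exp, le_div_iff₀ (by positivity)]
        nlinarith [sq_nonneg (N - 2 * c * t)]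

lemma norm_pow_mul_norm_iteratedFDeriv_cexp_comp_le {φ : E → ℂ} (hφ : φ.HasTemperateGrowth)
    {c : ℝ} (hc : 0 < c) (hre : ∀ v, (φ v).re ≤ -(c * ‖v‖ ^ 2)) (p q : ℕ) :
    ∃ C : ℝ, ∀ v, ‖v‖ ^ p * ‖iteratedFDeriv ℝ q (fun v => exp (φ v)) v‖ ≤ C := by
  obtain ⟨M, C, hC, hbound⟩ := norm_iteratedFDeriv_cexp_comp_le hφ q
  refine ⟨C * Real.exp ((p + M : ℕ) ^ 2 / (4 * c)), fun v => ?_⟩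
  calc ‖v‖ ^ p * ‖iteratedFDeriv ℝ q (fun v => exp (φ v)) v‖
      ≤ (1 + ‖v‖) ^ p * (C * (1 + ‖v‖) ^ M * Real.exp (-(c * ‖v‖ ^ 2))) := by
        gcongr
        · linarith
        · exact (hbound v).trans (by gcongr; exact hre v)
    _ = C * ((1 + ‖v‖) ^ (p + M) * Real.exp (-(c * ‖v‖ ^ 2))) := by
        rw [pow_add]
        ring
    _ ≤ C * Real.exp ((p + M : ℕ) ^ 2 / (4 * c)) := by
        gcongr
        exact one_add_pow_mul_exp_neg_sq_le hc (norm_nonneg v) _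

end Exponential

section Gaussian

variable {n : ℕ} {A : Matrix (Fin n) (Fin n) ℂ}

lemma matrixForm_im (A : Matrix (Fin n) (Fin n) ℂ) (v : RSpace n) :
    (matrixForm A v).im = ∑ p, ∑ q, (A p q).im * v q * v p := by
  simp [matrixForm, Complex.im_sum]

lemma matrixForm_smul (A : Matrix (Fin n) (Fin n) ℂ) (s : ℝ) (v : RSpace n) :
    matrixForm A (s • v) = (s : ℂ) ^ 2 * matrixForm A v := by
  simp only [matrixForm, Finset.mul_sum, PiLp.smul_apply, smul_eq_mul, Complex.ofReal_mul]
  exact Finset.sum_congr rfl fun _ _ => Finset.sum_congr rfl fun _ _ => by ring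

lemma hasTemperateGrowth_matrixForm (A : Matrix (Fin n) (Fin n) ℂ) :
    (matrixForm A).HasTemperateGrowth := by
  have hcoord (p : Fin n) : (fun v : RSpace n => (v p : ℂ)).HasTemperateGrowth :=
    (Complex.ofRealCLM.comp (EuclideanSpace.proj p)).hasTemperateGrowth
  unfold matrixForm
  fun_prop

namespace HasPosDefIm

lemma exists_coercive (hA : HasPosDefIm A) :
    ∃ c : ℝ, 0 < c ∧ ∀ v : RSpace n, c * ‖v‖ ^ 2 ≤ (matrixForm A v).im := by
  have hpos {v : RSpace n} (hv : v ≠ 0) : 0 < (matrixForm A v).im := matrixForm_im A v ▸ hA v hv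
  have hcont : ContinuousOn (fun v => (matrixForm A v).im) (Metric.sphere 0 1) :=
    (Complex.continuous_im.comp (hasTemperateGrowth_matrixForm A).1.continuous).continuousOn
  obtain ⟨c, hc, hmin⟩ := (isCompact_sphere (0 : RSpace n) 1).exists_forall_le' hcont
    fun v hv => hpos (ne_zero_of_mem_unit_sphere ⟨v, hv⟩)
  refine ⟨c, hc, fun v => ?_⟩
  rcases eq_or_ne v 0 with rfl | hv
  · simp [matrixForm]
  have hsphere := hmin (‖v‖⁻¹ • v) (by simp [norm_smul, hv])
  rw [matrixForm_smul, ← Complex.ofReal_pow, Complex.im_ofReal_mul, inv_pow] at hsphere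
  rwa [← le_div_iff₀ (by positivity), div_eq_inv_mul]

/-- The Gaussian `v ↦ e^{(i / 2) ⟨A v, v⟩}` as a Schwartz function. -/
noncomputable def gaussian (hA : HasPosDefIm A) : 𝓢(RSpace n, ℂ) where
  toFun v := exp (I / 2 * matrixForm A v)
  smooth' := by
    have := (hasTemperateGrowth_matrixForm A).1
    fun_prop
  decay' := by
    obtain ⟨c, hc, hcoercive⟩ := hA.exists_coercive
    have hA := hasTemperateGrowth_matrixForm A
    refine norm_pow_mul_norm_iteratedFDeriv_cexp_comp_le (c := c / 2) (by fun_prop) (by positivity)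
      fun v => ?_
    have hre : (I / 2 * matrixForm A v).re = -((matrixForm A v).im / 2) := by
      rw [div_mul_eq_mul_div, Complex.div_ofNat_re]
      simp [neg_div]
    rw [hre]
    linarith [hcoercive v]

lemma gaussian_apply (hA : HasPosDefIm A) (v : RSpace n) :
    hA.gaussian v = exp (I / 2 * matrixForm A v) :=
  rfl

end HasPosDefIm

end Gaussian

section RescaledState

lemma uniformlyTemperate_comp_contraction {ι E : Type*} [NormedAddCommGroup E] [NormedSpace ℝ E]
    {f : E → ℂ} (hf : f.HasTemperateGrowth) (c : E) {s : ι → ℝ} (hs : ∀ i, |s i| ≤ 1) :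
    UniformlyTemperate (fun _ => 1) (fun i v => f (c + s i • v)) := by
  have hsmooth := hf.1
  refine ⟨fun i => by fun_prop, fun q => ?_⟩
  obtain ⟨M, C, hC, hbound⟩ := hf.norm_iteratedFDeriv_le_uniform q
  refine ⟨M, isBigO_top_of_norm_le (C * (1 + ‖c‖) ^ M) (fun ⟨i, v⟩ => ?_) fun _ => by positivity⟩
  have hpoint : 1 + ‖c + s i • v‖ ≤ (1 + ‖c‖) * (1 + ‖v‖) := by
    have hsv : ‖s i • v‖ ≤ ‖v‖ := by
      rw [norm_smul]
      exact mul_le_of_le_one_left (norm_nonneg v) (hs i)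
    nlinarith [norm_add_le c (s i • v), mul_nonneg (norm_nonneg c) (norm_nonneg v)]
  calc ‖iteratedFDeriv ℝ q (fun v => f (c + s i • v)) v‖
      = |s i| ^ q * ‖iteratedFDeriv ℝ q f (c + s i • v)‖ := by
        rw [iteratedFDeriv_comp_affine hf.1, norm_smul, norm_pow, Real.norm_eq_abs]
    _ ≤ 1 * (C * (1 + ‖c + s i • v‖) ^ M) := by
        gcongr
        exacts [pow_le_one₀ (abs_nonneg _) (hs i), hbound q le_rfl _]
    _ ≤ 1 * (C * ((1 + ‖c‖) * (1 + ‖v‖)) ^ M) := by gcongr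
    _ = C * (1 + ‖c‖) ^ M * (1 * (1 + ‖v‖) ^ M) := by
        rw [mul_pow]
        ring

variable {n : ℕ} {A : Matrix (Fin n) (Fin n) ℂ} {b : RSpace n → ℂ}

/-- The coherent state in the variable `v = √k (x - x₀)`, stripped of its normalization and of
its oscillating factor. -/
noncomputable def rescaledState (x₀ : RSpace n) (hA : HasPosDefIm A) (b : RSpace n → ℂ) (k : ℝ) :
    𝓢(RSpace n, ℂ) :=
  smulLeftCLM ℂ (fun v => b (x₀ + (√k)⁻¹ • v)) hA.gaussian

lemma rescaledState_apply (x₀ : RSpace n) (hA : HasPosDefIm A) (hb : b.HasTemperateGrowth) (k : ℝ)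
    (v : RSpace n) : rescaledState x₀ hA b k v =
      b (x₀ + (√k)⁻¹ • v) * exp (I / 2 * matrixForm A v) := by
  have hdilate : (fun v : RSpace n => b (x₀ + (√k)⁻¹ • v)).HasTemperateGrowth :=
    hb.comp (g := b) (f := fun v => x₀ + (√k)⁻¹ • v) (by fun_prop)
  rw [rescaledState, smulLeftCLM_apply_apply hdilate, smul_eq_mul, hA.gaussian_apply]

lemma uniformlySchwartz_rescaledState (x₀ : RSpace n) (hA : HasPosDefIm A)
    (hb : b.HasTemperateGrowth) :
    UniformlySchwartz (fun _ => 1) (fun k : Set.Ici (1 : ℝ) => rescaledState x₀ hA b k) := by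
  have hgaussian : UniformlySchwartz (fun _ => 1) (fun _ : Set.Ici (1 : ℝ) => hA.gaussian) :=
    fun p q => isBigO_const_const _ one_ne_zero _
  have hdilate := uniformlyTemperate_comp_contraction hb x₀
    (s := fun k : Set.Ici (1 : ℝ) => (√(k : ℝ))⁻¹) fun k => by
      rw [abs_of_nonneg (by positivity)]
      exact inv_le_one_of_one_le₀ (Real.one_le_sqrt.2 k.2)
  simpa only [one_mul, rescaledState] using hgaussian.smulLeft hdilate

end RescaledState

section RescaledFrequency

lemma rpow_le_rpow_mul_pow_ceil {a b T : ℝ} (ha : 0 < a) (hb : 0 < b) (hT : 1 ≤ T)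
    (hab : a ≤ b * T) (hba : b ≤ a * T) (μ : ℝ) : a ^ μ ≤ b ^ μ * T ^ ⌈|μ|⌉₊ := by
  have hT0 : 0 < T := one_pos.trans_le hT
  have habs : a ^ μ ≤ b ^ μ * T ^ |μ| := by
    rcases le_total 0 μ with hμ | hμ
    · rw [abs_of_nonneg hμ, ← Real.mul_rpow hb.le hT0.le]
      exact Real.rpow_le_rpow ha.le hab hμ
    · rw [abs_of_nonpos hμ, Real.rpow_neg hT0.le, ← div_eq_mul_inv, ← Real.div_rpow hb.le hT0.le]
      exact Real.rpow_le_rpow_of_nonpos (by positivity) ((div_le_iff₀ hT0).2 hba) hμ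
  refine habs.trans ?_
  rw [← Real.rpow_natCast]
  gcongr
  exact Nat.le_ceil _

variable {n : ℕ}

/-- The frequency `k ξ₀ + 2π √k η`, in which `η` is the dual variable of `√k (x - x₀)`; the factor
`2π` matches the normalization of `𝓕`. -/
noncomputable def rescaledFrequency (ξ₀ : RSpace n) (k : ℝ) (η : RSpace n) : RSpace n :=
  k • ξ₀ + (2 * Real.pi * √k) • η

lemma rescaledFrequency_eq_smul (ξ₀ : RSpace n) {k : ℝ} (hk : 0 < k) (η : RSpace n) :
    rescaledFrequency ξ₀ k η = k • (ξ₀ + (2 * Real.pi * (√k)⁻¹) • η) := by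
  have hsq : √k * √k = k := Real.mul_self_sqrt hk.le
  rw [rescaledFrequency, smul_add, smul_smul]
  congr 2
  field_simp
  linear_combination hsq

variable {ξ₀ : RSpace n} {k : ℝ}

lemma one_add_norm_rescaledFrequency_le (hξ₀ : ‖ξ₀‖ = 1) (hk : 1 ≤ k) (η : RSpace n) :
    1 + ‖rescaledFrequency ξ₀ k η‖ ≤ k * (50 * (1 + ‖η‖) ^ 2) := by
  have htriangle : ‖rescaledFrequency ξ₀ k η‖ ≤ k + 2 * Real.pi * √k * ‖η‖ := by
    refine (norm_add_le _ _).trans_eq ?_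
    rw [norm_smul, norm_smul, hξ₀, mul_one, Real.norm_of_nonneg (by positivity),
      Real.norm_of_nonneg (by positivity)]
  have hsqrt : √k ≤ k := Real.sqrt_le_iff.2 ⟨by linarith, by nlinarith⟩
  have hcross : 2 * Real.pi * √k * ‖η‖ ≤ 7 * k * ‖η‖ := by
    gcongr
    linarith [Real.pi_lt_d2]
  nlinarith [mul_nonneg (by linarith : 0 ≤ k) (norm_nonneg η)]

lemma le_one_add_norm_rescaledFrequency_mul (hξ₀ : ‖ξ₀‖ = 1) (hk : 1 ≤ k) (η : RSpace n) :
    k ≤ (1 + ‖rescaledFrequency ξ₀ k η‖) * (50 * (1 + ‖η‖) ^ 2) := by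
  have htriangle : k ≤ ‖rescaledFrequency ξ₀ k η‖ + 2 * Real.pi * √k * ‖η‖ := by
    have h := norm_sub_le (rescaledFrequency ξ₀ k η) ((2 * Real.pi * √k) • η)
    rwa [rescaledFrequency, add_sub_cancel_right, norm_smul, norm_smul, hξ₀, mul_one,
      Real.norm_of_nonneg (by positivity), Real.norm_of_nonneg (by positivity)] at h
  have hcross : 2 * Real.pi * √k * ‖η‖ ≤ 7 * √k * ‖η‖ := by
    gcongr
    linarith [Real.pi_lt_d2]
  have hamgm : 7 * √k * ‖η‖ ≤ k / 2 + 25 * ‖η‖ ^ 2 := by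
    nlinarith [sq_nonneg (√k - 7 * ‖η‖), Real.sq_sqrt (by linarith : 0 ≤ k)]
  have hη := norm_nonneg η
  nlinarith [mul_nonneg (norm_nonneg (rescaledFrequency ξ₀ k η))
    (by nlinarith : 0 ≤ (1 + ‖η‖) ^ 2 - 1), norm_nonneg (rescaledFrequency ξ₀ k η)]

lemma one_add_norm_rescaledFrequency_rpow_le (hξ₀ : ‖ξ₀‖ = 1) (hk : 1 ≤ k) (μ : ℝ)
    (η : RSpace n) : (1 + ‖rescaledFrequency ξ₀ k η‖) ^ μ ≤
      k ^ μ * (50 * (1 + ‖η‖) ^ 2) ^ ⌈|μ|⌉₊ :=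
  rpow_le_rpow_mul_pow_ceil (by positivity) (by linarith) (by nlinarith [norm_nonneg η])
    (one_add_norm_rescaledFrequency_le hξ₀ hk η)
    (le_one_add_norm_rescaledFrequency_mul hξ₀ hk η) μ

lemma norm_rescaledPoint_sub_le (x₀ ξ₀ : RSpace n) (hk : 1 ≤ k) (x η : RSpace n) :
    ‖(x, ξ₀ + (2 * Real.pi * (√k)⁻¹) • η) - (x₀, ξ₀)‖ ≤
      7 * ((√k)⁻¹ * (1 + √k * ‖x - x₀‖)) * (1 + ‖η‖) := by
  have hsplit : 7 * ((√k)⁻¹ * (1 + √k * ‖x - x₀‖)) * (1 + ‖η‖) =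
      7 * (√k)⁻¹ * (1 + ‖η‖) + 7 * ‖x - x₀‖ * (1 + ‖η‖) := by
    field_simp
  have hpos : 0 ≤ 7 * (√k)⁻¹ * (1 + ‖η‖) := by positivity
  rw [hsplit, Prod.mk_sub_mk, add_sub_cancel_left, norm_prod_le_iff, norm_smul,
    Real.norm_of_nonneg (by positivity)]
  constructor
  · nlinarith [mul_nonneg (norm_nonneg (x - x₀)) (norm_nonneg η), norm_nonneg (x - x₀)]
  · have hη : 2 * Real.pi * (√k)⁻¹ * ‖η‖ ≤ 7 * (√k)⁻¹ * (1 + ‖η‖) := by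
      gcongr <;> linarith [Real.pi_lt_d2]
    linarith [show 0 ≤ 7 * ‖x - x₀‖ * (1 + ‖η‖) by positivity]

end RescaledFrequency

section Symbols

variable {n : ℕ} {x₀ ξ₀ : RSpace n} {μ c : ℝ} {r : ℕ} {f : RSpace n × RSpace n → ℂ}

lemma IsSymbol.exists_norm_iteratedFDeriv_rescaledFrequency_le (hf : IsSymbol μ f) (hξ₀ : ‖ξ₀‖ = 1)
    (q : ℕ) : ∃ (M : ℕ) (C : ℝ), 0 ≤ C ∧ ∀ k : ℝ, 1 ≤ k → ∀ x η : RSpace n,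
      ‖iteratedFDeriv ℝ q (fun ξ => f (x, ξ)) (rescaledFrequency ξ₀ k η)‖ ≤
        C * k ^ (μ - q) * (1 + ‖η‖) ^ M := by
  obtain ⟨C, hC⟩ := hf.bound 0 q
  set N := ⌈|μ - q|⌉₊
  refine ⟨2 * N, |C| * 50 ^ N, by positivity, fun k hk x η => ?_⟩
  have hbound := hC x (rescaledFrequency ξ₀ k η)
  rw [norm_iteratedFDeriv_zero] at hbound
  calc ‖iteratedFDeriv ℝ q (fun ξ => f (x, ξ)) (rescaledFrequency ξ₀ k η)‖
      ≤ |C| * (1 + ‖rescaledFrequency ξ₀ k η‖) ^ (μ - q) :=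
        hbound.trans (by gcongr; exact le_abs_self C)
    _ ≤ |C| * (k ^ (μ - q) * (50 * (1 + ‖η‖) ^ 2) ^ N) := by
        gcongr
        exact one_add_norm_rescaledFrequency_rpow_le hξ₀ hk _ η
    _ = |C| * 50 ^ N * k ^ (μ - q) * (1 + ‖η‖) ^ (2 * N) := by
        rw [mul_pow, ← pow_mul]
        ring

lemma IsHomogeneousAbove.iteratedFDeriv_smul (hhom : IsHomogeneousAbove c μ f)
    (hf : ContDiff ℝ ∞ f) (q : ℕ) (x : RSpace n) {ξ : RSpace n} {s : ℝ} (hs : 0 < s)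
    (hξ : c < ‖ξ‖) (hsξ : c < ‖s • ξ‖) :
    iteratedFDeriv ℝ q (fun ξ' => f (x, ξ')) (s • ξ) =
      s ^ (μ - q) • iteratedFDeriv ℝ q (fun ξ' => f (x, ξ')) ξ := by
  have hslice : ContDiff ℝ q (fun ξ' => f (x, ξ')) :=
    (hf.of_le (by exact_mod_cast le_top)).comp (contDiff_const.prodMk contDiff_id)
  have hlocal : (fun ξ' => f (x, s • ξ')) =ᶠ[𝓝 ξ] s ^ μ • fun ξ' => f (x, ξ') := by
    have hcont : Continuous fun ξ' : RSpace n => ‖s • ξ'‖ := by fun_prop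
    filter_upwards [continuous_norm.continuousAt.eventually (lt_mem_nhds hξ),
      hcont.continuousAt.eventually (lt_mem_nhds hsξ)] with ξ' h h'
    simpa using hhom x ξ' s hs h.le h'.le
  have hder := hlocal.iteratedFDeriv ℝ q |>.eq_of_nhds
  rw [iteratedFDeriv_comp_const_smul s hslice, iteratedFDeriv_const_smul_apply
    hslice.contDiffAt] at hder
  rw [Real.rpow_sub hs, Real.rpow_natCast, div_eq_inv_mul, mul_smul, ← hder, smul_smul,
    inv_mul_cancel₀ (by positivity), one_smul]

-- Near `(x₀, ξ₀)` homogeneity moves the frequency `k ξ` to `ξ`, where Taylor's formula applies.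
lemma IsHomogeneousAbove.exists_norm_iteratedFDeriv_rescaledFrequency_le_near
    (hhom : IsHomogeneousAbove c μ f) (hc : c < 1) (hf : ContDiff ℝ ∞ f) (hξ₀ : ‖ξ₀‖ = 1)
    (hv : VanishesToOrder r f (x₀, ξ₀)) (q : ℕ) :
    ∃ C δ : ℝ, 0 ≤ C ∧ 0 < δ ∧ ∀ k : ℝ, 1 ≤ k → ∀ x η : RSpace n,
      ‖(x, ξ₀ + (2 * Real.pi * (√k)⁻¹) • η) - (x₀, ξ₀)‖ ≤ δ →
      ‖iteratedFDeriv ℝ q (fun ξ => f (x, ξ)) (rescaledFrequency ξ₀ k η)‖ ≤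
        C * k ^ (μ - q) * ‖(x, ξ₀ + (2 * Real.pi * (√k)⁻¹) • η) - (x₀, ξ₀)‖ ^ (r - q) := by
  obtain ⟨C, hC, htaylor⟩ := (isBigO_iteratedFDeriv_of_forall_lt_eq_zero hf hv q).exists_nonneg
  have habove : ∀ᶠ z : RSpace n × RSpace n in 𝓝 (x₀, ξ₀), c < ‖z.2‖ :=
    continuous_snd.norm.continuousAt.eventually (lt_mem_nhds (by simpa only [hξ₀] using hc))
  obtain ⟨δ, hδ, hball⟩ :=
    Metric.nhds_basis_closedBall.eventually_iff.1 (htaylor.bound.and habove)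
  refine ⟨C, δ, hC, hδ, fun k hk x η hclose => ?_⟩
  obtain ⟨hbound, hξ⟩ := hball (mem_closedBall_iff_norm.2 hclose)
  set ξ := ξ₀ + (2 * Real.pi * (√k)⁻¹) • η
  have hkξ : c < ‖k • ξ‖ := by
    rw [norm_smul, Real.norm_of_nonneg (by positivity)]
    exact hξ.trans_le (le_mul_of_one_le_left (norm_nonneg ξ) hk)
  rw [rescaledFrequency_eq_smul ξ₀ (by positivity), hhom.iteratedFDeriv_smul hf q x (by positivity)
    hξ hkξ, norm_smul, Real.norm_of_nonneg (by positivity), mul_comm C, mul_assoc]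
  gcongr
  refine (norm_iteratedFDeriv_partial_right_le hf q x ξ).trans (hbound.trans_eq ?_)
  rw [norm_pow, norm_norm]

lemma IsSymbol.exists_norm_iteratedFDeriv_rescaledFrequency_le_of_vanishesToOrder
    (hf : IsSymbol μ f) (hhom : IsHomogeneousAbove c μ f) (hc : c < 1) (hξ₀ : ‖ξ₀‖ = 1)
    (hv : VanishesToOrder r f (x₀, ξ₀)) (q : ℕ) :
    ∃ (M : ℕ) (C : ℝ), 0 ≤ C ∧ ∀ k : ℝ, 1 ≤ k → ∀ x η : RSpace n,
      ‖iteratedFDeriv ℝ q (fun ξ => f (x, ξ)) (rescaledFrequency ξ₀ k η)‖ ≤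
        C * k ^ (μ - q) * ((√k)⁻¹ * (1 + √k * ‖x - x₀‖)) ^ (r - q) * (1 + ‖η‖) ^ M := by
  obtain ⟨C₁, δ, hC₁, hδ, hnear⟩ :=
    hhom.exists_norm_iteratedFDeriv_rescaledFrequency_le_near hc hf.smooth hξ₀ hv q
  obtain ⟨M, C₂, hC₂, hfar⟩ := hf.exists_norm_iteratedFDeriv_rescaledFrequency_le hξ₀ q
  refine ⟨M + (r - q), (C₁ + C₂ / δ ^ (r - q)) * 7 ^ (r - q), by positivity,
    fun k hk x η => ?_⟩
  set t := 7 * ((√k)⁻¹ * (1 + √k * ‖x - x₀‖)) * (1 + ‖η‖)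
  have ht := norm_rescaledPoint_sub_le x₀ ξ₀ hk x η
  have hη : 1 ≤ 1 + ‖η‖ := by linarith [norm_nonneg η]
  suffices ‖iteratedFDeriv ℝ q (fun ξ => f (x, ξ)) (rescaledFrequency ξ₀ k η)‖ ≤
      (C₁ + C₂ / δ ^ (r - q)) * (k ^ (μ - q) * (1 + ‖η‖) ^ M * t ^ (r - q)) by
    refine this.trans_eq ?_
    rw [pow_add, mul_pow, mul_pow 7]
    ring
  rw [add_mul]
  rcases le_or_gt ‖(x, ξ₀ + (2 * Real.pi * (√k)⁻¹) • η) - (x₀, ξ₀)‖ δ with hle | hgt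
  · refine (hnear k hk x η hle).trans (le_add_of_le_of_nonneg ?_ (by positivity))
    rw [mul_assoc]
    gcongr
    exact le_mul_of_one_le_right (by positivity) (one_le_pow₀ hη)
  · have hratio : 1 ≤ (t / δ) ^ (r - q) := one_le_pow₀ ((one_le_div hδ).2 (hgt.le.trans ht))
    refine le_add_of_nonneg_of_le (by positivity) ?_
    calc _ ≤ C₂ * k ^ (μ - q) * (1 + ‖η‖) ^ M * (t / δ) ^ (r - q) :=
          (hfar k hk x η).trans (le_mul_of_one_le_right (by positivity) hratio)
      _ = C₂ / δ ^ (r - q) * (k ^ (μ - q) * (1 + ‖η‖) ^ M * t ^ (r - q)) := by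
          rw [div_pow]
          ring

end Symbols

section RescaledSymbol

variable {n : ℕ} {x₀ ξ₀ : RSpace n} {μ : ℝ} {r : ℕ} {f : RSpace n × RSpace n → ℂ}

/-- The symbol `f` at the point `x = i.1` and at the rescaled frequency with parameter `k = i.2`,
as a function of the rescaled dual variable. -/
noncomputable def rescaledSymbol (f : RSpace n × RSpace n → ℂ) (ξ₀ : RSpace n)
    (i : RSpace n × Set.Ici (1 : ℝ)) (η : RSpace n) : ℂ :=
  f (i.1, rescaledFrequency ξ₀ i.2 η)

/-- The weight `k ^ ν (1 + √k |x - x₀|) ^ r` at `i = (x, k)`. A rescaled symbol of order `μ` that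
vanishes to order `r` at `(x₀, ξ₀)` is controlled by it with `ν = μ - r / 2`. -/
noncomputable def vanishingWeight (x₀ : RSpace n) (ν : ℝ) (r : ℕ)
    (i : RSpace n × Set.Ici (1 : ℝ)) : ℝ :=
  (i.2 : ℝ) ^ ν * (1 + √i.2 * ‖i.1 - x₀‖) ^ r

lemma vanishingWeight_nonneg (x₀ : RSpace n) (ν : ℝ) (r : ℕ) (i : RSpace n × Set.Ici (1 : ℝ)) :
    0 ≤ vanishingWeight x₀ ν r i :=
  mul_nonneg (Real.rpow_nonneg (zero_le_one.trans i.2.2) ν) (by positivity)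

lemma isBigO_vanishingWeight (x₀ : RSpace n) {ν ν' : ℝ} {r r' : ℕ} (hν : ν ≤ ν') (hr : r ≤ r') :
    vanishingWeight x₀ ν r =O[⊤] vanishingWeight x₀ ν' r' := by
  refine isBigO_top_of_norm_le 1 (fun i => ?_) (vanishingWeight_nonneg x₀ ν' r')
  have hk : (1 : ℝ) ≤ i.2 := i.2.2
  rw [one_mul, Real.norm_of_nonneg (vanishingWeight_nonneg x₀ ν r i)]
  unfold vanishingWeight
  gcongr
  exact le_add_of_nonneg_right (by positivity)

lemma sqrt_pow_mul_rpow_mul_pow_le {k Z : ℝ} (hk : 1 ≤ k) (hZ : 1 ≤ Z) (μ : ℝ) (q r : ℕ) :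
    √k ^ q * k ^ (μ - q) * ((√k)⁻¹ * Z) ^ (r - q) ≤ k ^ (μ - r / 2) * Z ^ r := by
  have hk0 : 0 < k := one_pos.trans_le hk
  have hs : 1 ≤ √k := Real.one_le_sqrt.2 hk
  calc √k ^ q * k ^ (μ - q) * ((√k)⁻¹ * Z) ^ (r - q)
      = k ^ μ * (√k)⁻¹ ^ (q + (r - q)) * Z ^ (r - q) := by
        have hkq : k ^ q = √k ^ q * √k ^ q := by rw [← mul_pow, Real.mul_self_sqrt hk0.le]
        rw [Real.rpow_sub hk0, Real.rpow_natCast, hkq, pow_add, mul_pow, inv_pow, inv_pow]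
        field_simp
    _ ≤ k ^ μ * (√k)⁻¹ ^ r * Z ^ r := by
        have hpow : (√k)⁻¹ ^ (q + (r - q)) ≤ (√k)⁻¹ ^ r :=
          pow_le_pow_of_le_one (by positivity) (inv_le_one_of_one_le₀ hs) (by omega)
        gcongr
        exact Nat.sub_le r q
    _ = k ^ (μ - r / 2) * Z ^ r := by
        rw [Real.rpow_sub hk0, Real.rpow_div_two_eq_sqrt _ hk0.le, Real.rpow_natCast, inv_pow,
          div_eq_mul_inv]

lemma uniformlyTemperate_rescaledSymbol_of_bound (hf : ContDiff ℝ ∞ f)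
    (h : ∀ q : ℕ, ∃ (M : ℕ) (C : ℝ), 0 ≤ C ∧ ∀ k : ℝ, 1 ≤ k → ∀ x η : RSpace n,
      ‖iteratedFDeriv ℝ q (fun ξ => f (x, ξ)) (rescaledFrequency ξ₀ k η)‖ ≤
        C * k ^ (μ - q) * ((√k)⁻¹ * (1 + √k * ‖x - x₀‖)) ^ (r - q) * (1 + ‖η‖) ^ M) :
    UniformlyTemperate (vanishingWeight x₀ (μ - r / 2) r) (rescaledSymbol f ξ₀) := by
  have hslice (x : RSpace n) : ContDiff ℝ ∞ (fun ξ => f (x, ξ)) := by fun_prop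
  refine ⟨fun i => (hslice i.1).comp (by unfold rescaledFrequency; fun_prop), fun q => ?_⟩
  obtain ⟨M, C, hC, hbound⟩ := h q
  refine ⟨M, isBigO_top_of_norm_le (C * (2 * Real.pi) ^ q) (fun ⟨⟨x, k, hk⟩, η⟩ => ?_)
    fun p => mul_nonneg (vanishingWeight_nonneg x₀ _ r p.1) (by positivity)⟩
  have hder : iteratedFDeriv ℝ q (rescaledSymbol f ξ₀ (x, ⟨k, hk⟩)) η =
      (2 * Real.pi * √k) ^ q •
        iteratedFDeriv ℝ q (fun ξ => f (x, ξ)) (rescaledFrequency ξ₀ k η) :=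
    iteratedFDeriv_comp_affine (hslice x) q (k • ξ₀) (2 * Real.pi * √k) η
  have hgain := sqrt_pow_mul_rpow_mul_pow_le hk
    (le_add_of_nonneg_right (by positivity) : 1 ≤ 1 + √k * ‖x - x₀‖) μ q r
  rw [hder, norm_smul, Real.norm_of_nonneg (by positivity)]
  calc (2 * Real.pi * √k) ^ q *
        ‖iteratedFDeriv ℝ q (fun ξ => f (x, ξ)) (rescaledFrequency ξ₀ k η)‖
      ≤ (2 * Real.pi * √k) ^ q * (C * k ^ (μ - q) *
          ((√k)⁻¹ * (1 + √k * ‖x - x₀‖)) ^ (r - q) * (1 + ‖η‖) ^ M) := by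
        gcongr
        exact hbound k hk x η
    _ = C * (2 * Real.pi) ^ q * ((√k ^ q * k ^ (μ - q) *
          ((√k)⁻¹ * (1 + √k * ‖x - x₀‖)) ^ (r - q)) * (1 + ‖η‖) ^ M) := by
        rw [mul_pow _ √k]
        ring
    _ ≤ C * (2 * Real.pi) ^ q *
          (vanishingWeight x₀ (μ - r / 2) r (x, ⟨k, hk⟩) * (1 + ‖η‖) ^ M) := by
        gcongr
        exact hgain

lemma IsSymbol.uniformlyTemperate_rescaledSymbol (hf : IsSymbol μ f) (x₀ : RSpace n)
    (hξ₀ : ‖ξ₀‖ = 1) :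
    UniformlyTemperate (vanishingWeight x₀ μ 0) (rescaledSymbol f ξ₀) := by
  have h := uniformlyTemperate_rescaledSymbol_of_bound (x₀ := x₀) (r := 0) hf.smooth fun q => by
    simpa only [Nat.zero_sub, pow_zero, mul_one] using
      hf.exists_norm_iteratedFDeriv_rescaledFrequency_le hξ₀ q
  simpa only [Nat.cast_zero, zero_div, sub_zero] using h

lemma HasPolyhomogeneousExpansion.uniformlyTemperate_rescaledSymbol (hξ₀ : ‖ξ₀‖ = 1) {m : ℝ}
    {a : RSpace n × RSpace n → ℂ} {aj : ℕ → RSpace n × RSpace n → ℂ}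
    (ha : HasPolyhomogeneousExpansion m a aj) {ℓ : ℕ}
    (hv : ∀ j : ℕ, 2 * j ≤ ℓ → VanishesToOrder (ℓ - 2 * j) (aj j) (x₀, ξ₀)) :
    UniformlyTemperate (vanishingWeight x₀ (m - ℓ / 2) ℓ) (rescaledSymbol a ξ₀) := by
  set N := ℓ / 2 + 1
  have hremainder := ((ha.remainder N).uniformlyTemperate_rescaledSymbol x₀ hξ₀).mono <|
    isBigO_vanishingWeight x₀ (ν' := m - ℓ / 2) (r' := ℓ) (by
      have : (ℓ : ℝ) ≤ 2 * N := by exact_mod_cast (by omega : ℓ ≤ 2 * N)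
      linarith) ℓ.zero_le
  have hterm : ∀ j ∈ Finset.range N,
      UniformlyTemperate (vanishingWeight x₀ (m - ℓ / 2) ℓ) (rescaledSymbol (aj j) ξ₀) := by
    intro j hj
    have hjℓ : 2 * j ≤ ℓ := by
      have := Finset.mem_range.1 hj
      omega
    obtain ⟨c, -, hc, hhom⟩ := ha.term_homogeneous j
    have hsymbol := ha.term_symbol j
    have horder : m - j - (ℓ - 2 * j : ℕ) / 2 = m - ℓ / 2 := by
      push_cast [hjℓ]
      ring
    exact (uniformlyTemperate_rescaledSymbol_of_bound hsymbol.smooth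
      (hsymbol.exists_norm_iteratedFDeriv_rescaledFrequency_le_of_vanishesToOrder hhom hc hξ₀
        (hv j hjℓ))).mono (isBigO_vanishingWeight x₀ horder.le (Nat.sub_le _ _))
  have hsplit : rescaledSymbol a ξ₀ = fun i η =>
      rescaledSymbol (fun z => a z - ∑ j ∈ Finset.range N, aj j z) ξ₀ i η +
        ∑ j ∈ Finset.range N, rescaledSymbol (aj j) ξ₀ i η := by
    ext i η
    simp only [rescaledSymbol, sub_add_cancel]
  exact hsplit ▸ hremainder.add (.sum hterm)

end RescaledSymbol

section Quantization

variable {n : ℕ}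

lemma integral_eq_smul_integral_affine {E F : Type*} [NormedAddCommGroup E] [NormedSpace ℝ E]
    [FiniteDimensional ℝ E] [MeasurableSpace E] [BorelSpace E] (μ : Measure E)
    [μ.IsAddHaarMeasure] [NormedAddCommGroup F] [NormedSpace ℝ F] (f : E → F) (c : E) {s : ℝ}
    (hs : 0 < s) :
    ∫ v, f v ∂μ = s ^ Module.finrank ℝ E • ∫ v, f (c + s • v) ∂μ := by
  rw [Measure.integral_comp_smul μ (fun v => f (c + v)) s, integral_add_left_eq_self f c,
    abs_of_pos (by positivity), smul_inv_smul₀ (by positivity)]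

/-- The profile `ψ` concentrated at scale `s⁻¹` around `x₀` and oscillating with frequency `ζ`. -/
noncomputable def wavePacket (x₀ ζ : RSpace n) (s : ℝ) (ψ : RSpace n → ℂ) (y : RSpace n) : ℂ :=
  exp (I * ((inner ℝ (y - x₀) ζ : ℝ) : ℂ)) * ψ (s • (y - x₀))

lemma cexp_inner_mul_wavePacket (x₀ ζ x η w : RSpace n) {s : ℝ} (hs : s ≠ 0) (ψ : RSpace n → ℂ) :
    exp (I * ((inner ℝ (x - (x₀ + s⁻¹ • w)) (ζ + (2 * Real.pi * s) • η) : ℝ) : ℂ)) *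
        wavePacket x₀ ζ s ψ (x₀ + s⁻¹ • w) =
      exp (I * ((inner ℝ (x - x₀) ζ : ℝ) : ℂ)) *
        exp (((2 * Real.pi * inner ℝ η (s • (x - x₀)) : ℝ) : ℂ) * I) *
        (exp (((-2 * Real.pi * inner ℝ w η : ℝ) : ℂ) * I) * ψ w) := by
  have hsc : (s : ℂ) ≠ 0 := by exact_mod_cast hs
  rw [wavePacket, add_sub_cancel_left, smul_inv_smul₀ hs, ← mul_assoc, ← mul_assoc,
    ← Complex.exp_add, ← Complex.exp_add, ← Complex.exp_add, ← sub_sub]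
  congr 2
  simp only [inner_sub_left, inner_add_right, inner_smul_left, inner_smul_right,
    real_inner_comm (x - x₀) η, RCLike.conj_to_real]
  push_cast
  field_simp
  ring

lemma integral_cexp_mul_wavePacket (a : RSpace n × RSpace n → ℂ) (x₀ ζ x η : RSpace n) {s : ℝ}
    (hs : 0 < s) (ψ : RSpace n → ℂ) :
    ∫ y, exp (I * ((inner ℝ (x - y) (ζ + (2 * Real.pi * s) • η) : ℝ) : ℂ)) *
        a (x, ζ + (2 * Real.pi * s) • η) * wavePacket x₀ ζ s ψ y =
      ((s⁻¹ ^ n : ℝ) : ℂ) * exp (I * ((inner ℝ (x - x₀) ζ : ℝ) : ℂ)) *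
        (exp (((2 * Real.pi * inner ℝ η (s • (x - x₀)) : ℝ) : ℂ) * I) *
          (a (x, ζ + (2 * Real.pi * s) • η) * 𝓕 ψ η)) := by
  rw [integral_eq_smul_integral_affine volume _ x₀ (inv_pos.2 hs), finrank_euclideanSpace_fin,
    Complex.real_smul, mul_assoc ((s⁻¹ ^ n : ℝ) : ℂ)]
  congr 1
  rw [Real.fourier_eq', ← integral_const_mul, ← integral_const_mul, ← integral_const_mul]
  congr 1 with w
  rw [mul_right_comm, cexp_inner_mul_wavePacket x₀ ζ x η w hs.ne', smul_eq_mul]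
  ring

lemma Op_wavePacket (a : RSpace n × RSpace n → ℂ) (x₀ ζ x : RSpace n) {s : ℝ} (hs : 0 < s)
    (ψ : RSpace n → ℂ) :
    Op a (wavePacket x₀ ζ s ψ) x = exp (I * ((inner ℝ (x - x₀) ζ : ℝ) : ℂ)) *
      𝓕⁻ (fun η => a (x, ζ + (2 * Real.pi * s) • η) * 𝓕 ψ η) (s • (x - x₀)) := by
  have hscale : ((2 * Real.pi) ^ n)⁻¹ * ((2 * Real.pi * s) ^ n * s⁻¹ ^ n) = 1 := by
    rw [mul_pow _ s, inv_pow]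
    field_simp
  rw [Op, integral_eq_smul_integral_affine volume _ ζ (by positivity : 0 < 2 * Real.pi * s),
    finrank_euclideanSpace_fin, Complex.real_smul]
  simp only [integral_cexp_mul_wavePacket a x₀ ζ x _ hs]
  rw [integral_const_mul, Real.fourierInv_eq']
  simp only [← mul_assoc, smul_eq_mul]
  rw [← Complex.ofReal_inv, ← Complex.ofReal_mul, ← Complex.ofReal_mul, mul_assoc _ _ (s⁻¹ ^ n),
    hscale, Complex.ofReal_one, one_mul]

lemma Op_const_mul (a : RSpace n × RSpace n → ℂ) (c : ℂ) (u : RSpace n → ℂ) (x : RSpace n) :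
    Op a (fun y => c * u y) x = c * Op a u x := by
  simp only [Op, mul_left_comm _ c, integral_const_mul]

lemma coherentState_eq_wavePacket (x₀ ξ₀ : RSpace n) {A : Matrix (Fin n) (Fin n) ℂ}
    (hA : HasPosDefIm A) {b : RSpace n → ℂ} (hb : b.HasTemperateGrowth) {k : ℝ} (hk : 0 < k) :
    coherentState x₀ ξ₀ A b k = fun y => ((k ^ ((n : ℝ) / 4) : ℝ) : ℂ) *
      wavePacket x₀ (k • ξ₀) √k (rescaledState x₀ hA b k) y := by
  ext y
  have hs : √k ≠ 0 := (Real.sqrt_pos.2 hk).ne'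
  rw [coherentState, wavePacket, rescaledState_apply x₀ hA hb, inv_smul_smul₀ hs, add_sub_cancel,
    matrixForm_smul, ← Complex.ofReal_pow, Real.sq_sqrt hk.le, inner_smul_right,
    Complex.ofReal_mul]
  ring_nf

lemma norm_Op_coherentState (a : RSpace n × RSpace n → ℂ) (x₀ ξ₀ : RSpace n)
    {A : Matrix (Fin n) (Fin n) ℂ} (hA : HasPosDefIm A) {b : RSpace n → ℂ}
    (hb : b.HasTemperateGrowth) {k : ℝ} (hk : 0 < k) (x : RSpace n) :
    ‖Op a (coherentState x₀ ξ₀ A b k) x‖ = k ^ ((n : ℝ) / 4) *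
      ‖𝓕⁻ (fun η => a (x, rescaledFrequency ξ₀ k η) * 𝓕 (rescaledState x₀ hA b k : RSpace n → ℂ) η)
        (√k • (x - x₀))‖ := by
  rw [coherentState_eq_wavePacket x₀ ξ₀ hA hb hk, Op_const_mul,
    Op_wavePacket a x₀ _ x (Real.sqrt_pos.2 hk), norm_mul, norm_mul, mul_comm I,
    Complex.norm_exp_ofReal_mul_I, one_mul, Complex.norm_real,
    Real.norm_of_nonneg (by positivity)]
  rfl

lemma stronglyMeasurable_Op {a : RSpace n × RSpace n → ℂ} (ha : Continuous a) {u : RSpace n → ℂ}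
    (hu : Continuous u) : StronglyMeasurable (Op a u) := by
  have hintegrand : StronglyMeasurable (fun p : (RSpace n × RSpace n) × RSpace n =>
      exp (I * ((inner ℝ (p.1.1 - p.2) p.1.2 : ℝ) : ℂ)) * a (p.1.1, p.1.2) * u p.2) :=
    Continuous.stronglyMeasurable (by fun_prop)
  exact (hintegrand.integral_prod_right.integral_prod_right).const_mul _

lemma continuous_coherentState (x₀ ξ₀ : RSpace n) (A : Matrix (Fin n) (Fin n) ℂ)
    {b : RSpace n → ℂ} (hb : Continuous b) (k : ℝ) : Continuous (coherentState x₀ ξ₀ A b k) := by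
  unfold coherentState matrixForm
  fun_prop

end Quantization

section Decay

variable {n : ℕ} {x₀ ξ₀ : RSpace n} {A : Matrix (Fin n) (Fin n) ℂ} {b : RSpace n → ℂ} {m : ℝ}
  {a : RSpace n × RSpace n → ℂ} {aj : ℕ → RSpace n × RSpace n → ℂ} {ℓ : ℕ}

lemma UniformlyTemperate.uniformlySchwartz_fourierMultiplierCLM {ι κ E : Type*}
    [NormedAddCommGroup E] [InnerProductSpace ℝ E] [FiniteDimensional ℝ E] [MeasurableSpace E]
    [BorelSpace E] {w : ι → ℝ} {F : ι → E → ℂ} (hF : UniformlyTemperate w F) {G : κ → 𝓢(E, ℂ)}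
    (hG : UniformlySchwartz (fun _ => 1) G) (φ : ι → κ) :
    UniformlySchwartz w (fun i => fourierMultiplierCLM ℂ (F i) (G (φ i))) := by
  have hfourier := (hG.map (FourierTransform.fourierCLM ℂ _)).comp φ
  have hmultiplier := (hfourier.smulLeft hF).map (FourierTransform.fourierInvCLM ℂ _)
  simp only [mul_one] at hmultiplier
  exact hmultiplier

lemma exists_norm_Op_coherentState_le (hξ₀ : ‖ξ₀‖ = 1) (hb : b.HasTemperateGrowth)
    (hA : HasPosDefIm A) (ha : HasPolyhomogeneousExpansion m a aj)
    (hv : ∀ j : ℕ, 2 * j ≤ ℓ → VanishesToOrder (ℓ - 2 * j) (aj j) (x₀, ξ₀)) (P : ℕ) :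
    ∃ C : ℝ, 0 ≤ C ∧ ∀ k : ℝ, 1 ≤ k → ∀ x : RSpace n,
      ‖Op a (coherentState x₀ ξ₀ A b k) x‖ ≤
        C * k ^ (m - ℓ / 2) * (k ^ ((n : ℝ) / 4) * (1 + ‖√k • (x - x₀)‖) ^ (-P : ℝ)) := by
  have hsymbol := ha.uniformlyTemperate_rescaledSymbol hξ₀ hv
  have hschwartz := hsymbol.uniformlySchwartz_fourierMultiplierCLM
    (uniformlySchwartz_rescaledState x₀ hA hb) Prod.snd
  obtain ⟨C, hC, hdecay⟩ :=
    (UniformlySchwartz.iff_isBigO_iteratedFDeriv.1 hschwartz (P + ℓ) 0).exists_nonneg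
  refine ⟨C, hC, fun k hk x => ?_⟩
  set z := √k • (x - x₀)
  set u := 𝓕⁻ (fun η => a (x, rescaledFrequency ξ₀ k η) *
    𝓕 (rescaledState x₀ hA b k : RSpace n → ℂ) η) z
  have hz : √k * ‖x - x₀‖ = ‖z‖ := by rw [norm_smul, Real.norm_of_nonneg (by positivity)]
  have hu : (1 + ‖z‖) ^ (P + ℓ) * ‖u‖ ≤ C * (k ^ (m - ℓ / 2) * (1 + ‖z‖) ^ ℓ) := by
    have h := isBigOWith_top.1 hdecay ((x, ⟨k, hk⟩), z)
    rw [Real.norm_of_nonneg (by positivity), norm_iteratedFDeriv_zero,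
      Real.norm_of_nonneg (vanishingWeight_nonneg _ _ _ _), fourierMultiplierCLM_apply,
      SchwartzMap.fourierInv_coe, smulLeftCLM_apply (hsymbol.hasTemperateGrowth _)] at h
    simpa only [vanishingWeight, rescaledSymbol, hz, SchwartzMap.fourier_coe, smul_eq_mul] using h
  have hu' : ‖u‖ ≤ C * k ^ (m - ℓ / 2) * (1 + ‖z‖) ^ (-P : ℝ) := by
    rw [Real.rpow_neg (by positivity), Real.rpow_natCast, ← div_eq_mul_inv,
      le_div_iff₀ (by positivity)]
    refine le_of_mul_le_mul_right ?_ (by positivity : 0 < (1 + ‖z‖) ^ ℓ)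
    linear_combination hu
  rw [norm_Op_coherentState a x₀ ξ₀ hA hb (by positivity)]
  linear_combination k ^ ((n : ℝ) / 4) * hu'

end Decay

section Dilation

lemma eLpNorm_comp_dilation {E F : Type*} [NormedAddCommGroup E] [NormedSpace ℝ E]
    [FiniteDimensional ℝ E] [MeasurableSpace E] [BorelSpace E] (μ : Measure E) [μ.IsAddHaarMeasure]
    [NormedAddCommGroup F] {p : ENNReal} (hp : p ≠ ⊤) (g : E → F) (c : E) {s : ℝ} (hs : s ≠ 0) :
    eLpNorm (fun x => g (s • (x - c))) p μ =
      ENNReal.ofReal |(s ^ Module.finrank ℝ E)⁻¹| ^ (1 / p).toReal * eLpNorm g p μ := by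
  have htranslate : eLpNorm (fun x => g (s • (x - c))) p μ = eLpNorm (fun x => g (s • x)) p μ := by
    have h := (measurableEmbedding_subRight c).eLpNorm_map_measure (μ := μ) (p := p)
      (g := fun x => g (s • x))
    rwa [(measurePreserving_sub_right μ c).map_eq, eq_comm] at h
  rw [htranslate, ← smul_eq_mul, ← eLpNorm_smul_measure_of_ne_top hp,
    ← Measure.map_addHaar_smul μ hs]
  exact ((measurableEmbedding_const_smul₀ hs).eLpNorm_map_measure).symm

lemma eLpNorm_two_normalized_dilation {n : ℕ} (g : RSpace n → ℝ) (c : RSpace n) {k : ℝ}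
    (hk : 0 < k) :
    eLpNorm (fun x => k ^ ((n : ℝ) / 4) * g (√k • (x - c))) 2 volume = eLpNorm g 2 volume := by
  have hscale : k ^ ((n : ℝ) / 4) * |(√k ^ n)⁻¹| ^ (1 / 2 : ℝ) = 1 := by
    rw [abs_of_nonneg (by positivity), Real.inv_rpow (by positivity), ← Real.rpow_natCast,
      ← Real.rpow_div_two_eq_sqrt _ hk.le, ← Real.rpow_mul hk.le]
    rw [show (n : ℝ) / 2 * (1 / 2) = n / 4 by ring]
    exact mul_inv_cancel₀ (by positivity)
  have hconst := eLpNorm_const_smul (k ^ ((n : ℝ) / 4)) (fun x => g (√k • (x - c))) 2 volume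
  rw [eLpNorm_comp_dilation volume ENNReal.ofNat_ne_top g c (Real.sqrt_pos.2 hk).ne',
    finrank_euclideanSpace_fin, Real.enorm_of_nonneg (by positivity), ← mul_assoc,
    ENNReal.toReal_div, ENNReal.toReal_one, ENNReal.toReal_ofNat,
    ENNReal.ofReal_rpow_of_nonneg (by positivity) (by positivity),
    ← ENNReal.ofReal_mul (by positivity), hscale, ENNReal.ofReal_one, one_mul] at hconst
  exact hconst

end Dilation

theorem mainTheorem4_general {n : ℕ} {x₀ ξ₀ : RSpace n} (hξ₀ : ‖ξ₀‖ = 1)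
    {b : RSpace n → ℂ} (hb : b.HasTemperateGrowth)
    {A : Matrix (Fin n) (Fin n) ℂ} (hA : HasPosDefIm A)
    {m : ℝ} {a : RSpace n × RSpace n → ℂ} {aj : ℕ → RSpace n × RSpace n → ℂ}
    (ha : HasPolyhomogeneousExpansion m a aj)
    {ℓ : ℕ} (hvanish : ∀ j : ℕ, 2 * j ≤ ℓ → VanishesToOrder (ℓ - 2 * j) (aj j) (x₀, ξ₀)) :
    ∃ C : ℝ, 0 < C ∧ ∀ k : ℝ, 1 ≤ k →
      MemLp (Op a (coherentState x₀ ξ₀ A b k)) 2 volume ∧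
      eLpNorm (Op a (coherentState x₀ ξ₀ A b k)) 2 volume
        ≤ ENNReal.ofReal (C * k ^ (m - (ℓ : ℝ) / 2)) := by
  obtain ⟨P, hP⟩ := Measure.HasTemperateGrowth.exists_eLpNorm_lt_top 2
    (inferInstance : (volume : Measure (RSpace n)).HasTemperateGrowth)
  set J := eLpNorm (fun x : RSpace n => (1 + ‖x‖) ^ (-P : ℝ)) 2 volume
  obtain ⟨C, hC, hdecay⟩ := exists_norm_Op_coherentState_le hξ₀ hb hA ha hvanish P
  refine ⟨C * J.toReal + 1, by positivity, fun k hk => ?_⟩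
  have hJ : J = eLpNorm (fun x => k ^ ((n : ℝ) / 4) * (1 + ‖√k • (x - x₀)‖) ^ (-P : ℝ)) 2 volume :=
    (eLpNorm_two_normalized_dilation _ x₀ (by positivity)).symm
  have hle : eLpNorm (Op a (coherentState x₀ ξ₀ A b k)) 2 volume ≤
      ENNReal.ofReal ((C * J.toReal + 1) * k ^ (m - (ℓ : ℝ) / 2)) := by
    calc eLpNorm (Op a (coherentState x₀ ξ₀ A b k)) 2 volume
        ≤ ENNReal.ofReal (C * k ^ (m - (ℓ : ℝ) / 2)) * J := by
          rw [hJ, ← Real.enorm_of_nonneg (by positivity), ← eLpNorm_const_smul]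
          exact eLpNorm_mono_real (hdecay k hk)
      _ = ENNReal.ofReal (C * J.toReal * k ^ (m - (ℓ : ℝ) / 2)) := by
          rw [mul_right_comm, ENNReal.ofReal_mul' ENNReal.toReal_nonneg,
            ENNReal.ofReal_toReal hP.ne]
      _ ≤ ENNReal.ofReal ((C * J.toReal + 1) * k ^ (m - (ℓ : ℝ) / 2)) := by
          gcongr
          linarith
  have hsmooth : IsSymbol m a := by simpa using ha.remainder 0
  have hmeas := stronglyMeasurable_Op hsmooth.smooth.continuous
    (continuous_coherentState x₀ ξ₀ A hb.1.continuous k)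
  exact ⟨⟨hmeas.aestronglyMeasurable, hle.trans_lt ENNReal.ofReal_lt_top⟩, hle⟩

theorem mainTheorem4 (n : ℕ) (x₀ ξ₀ : RSpace n) (hξ₀ : ‖ξ₀‖ = 1)
    (b : RSpace n → ℂ) (hb : ContDiff ℝ ∞ b) (hb_supp : HasCompactSupport b)
    (A : Matrix (Fin n) (Fin n) ℂ) (hA : HasPosDefIm A)
    (m : ℝ) (a : RSpace n × RSpace n → ℂ) (aj : ℕ → RSpace n × RSpace n → ℂ)
    (ha : HasPolyhomogeneousExpansion m a aj)
    (ha_supp : ∃ K : Set (RSpace n), IsCompact K ∧ ∀ x ∉ K, ∀ ξ, a (x, ξ) = 0)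
    (ℓ : ℕ) (hvanish : ∀ j : ℕ, 2 * j ≤ ℓ → VanishesToOrder (ℓ - 2 * j) (aj j) (x₀, ξ₀)) :
    ∀ ε : ℝ, 0 < ε → ∃ C : ℝ, 0 < C ∧ ∀ k : ℝ, 1 ≤ k →
      MemLp (Op a (coherentState x₀ ξ₀ A b k)) 2 volume ∧
      eLpNorm (Op a (coherentState x₀ ξ₀ A b k)) 2 volume
        ≤ ENNReal.ofReal (C * k ^ (m - (ℓ : ℝ) / 2 + ε)) := by
  intro ε hε
  obtain ⟨C, hC, h⟩ :=
    mainTheorem4_general hξ₀ (hb_supp.toSchwartzMap hb).hasTemperateGrowth hA ha hvanish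
  exact ⟨C, hC, fun k hk => ⟨(h k hk).1, (h k hk).2.trans (by gcongr; linarith)⟩⟩
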